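/- Let $X$ be a real Banach space with closed unit ball $B_X$, dual $X^*$ and bidual $X^{**}$. For a bounded sequence $(x^*_n)$ in $X^*$ put $$\delta_w(x^*_n)=\sup_{x^{**}\in B_{X^{**}}}\ \inf_{n\in\mathbb N}\ \sup_{k,l\ge n}|x^{**}(x^*_k)-x^{**}(x^*_l)|,\qquad \delta_{w^*}(x^*_n)=\sup_{x\in B_X}\ \inf_{n\in\mathbb N}\ \sup_{k,l\ge n}|x^*_k(x)-x^*_l(x)|.$$ For a real number $c\ge 1$, the space $X$ is called $c$-Grothendieck if $\delta_w(x^*_n)\le c\,\delta_{w^*}(x^*_n)$ for every bounded sequence $(x^*_n)$ in $X^*$. Theorem. For every set $\Gamma$, the space $\ell_\infty(\Gamma)$ of all bounded functions $\Gamma\to\mathbb R$ with the supremum norm is $1$-Grothendieck. -/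

import Mathlib

open scoped ENNReal

/-- The measure of weak non-Cauchyness of a sequence `(x*_n)` in the dual of a real normed space:
`sup_{x** ∈ B_{X**}} inf_n sup_{k,l ≥ n} |x**(x*_k) - x**(x*_l)|`, with values in `[0, ∞]`
(it is finite when the sequence is bounded). -/
noncomputable def deltaWeak {X : Type*} [NormedAddCommGroup X] [NormedSpace ℝ X]
    (f : ℕ → StrongDual ℝ X) : ℝ≥0∞ :=
  ⨆ φ ∈ Metric.closedBall (0 : StrongDual ℝ (StrongDual ℝ X)) 1,
    ⨅ n : ℕ, ⨆ k ≥ n, ⨆ l ≥ n, ENNReal.ofReal |φ (f k) - φ (f l)|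

/-- The measure of weak-star non-Cauchyness of a sequence `(x*_n)` in the dual of a real normed
space: `sup_{x ∈ B_X} inf_n sup_{k,l ≥ n} |x*_k(x) - x*_l(x)|`, with values in `[0, ∞]`
(it is finite when the sequence is bounded). -/
noncomputable def deltaWeakStar {X : Type*} [NormedAddCommGroup X] [NormedSpace ℝ X]
    (f : ℕ → StrongDual ℝ X) : ℝ≥0∞ :=
  ⨆ x ∈ Metric.closedBall (0 : X) 1,
    ⨅ n : ℕ, ⨆ k ≥ n, ⨆ l ≥ n, ENNReal.ofReal |f k x - f l x|

/-- A real Banach space `X` is `c`-Grothendieck, for a real number `c ≥ 1`, if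
`δ_w(x*_n) ≤ c δ_{w*}(x*_n)` for every bounded sequence `(x*_n)` in `X*`. -/
def IsQuantGrothendieck (c : ℝ) (X : Type*) [NormedAddCommGroup X] [NormedSpace ℝ X]
    [CompleteSpace X] : Prop :=
  1 ≤ c ∧ ∀ f : ℕ → StrongDual ℝ X, Bornology.IsBounded (Set.range f) →
    deltaWeak f ≤ ENNReal.ofReal c * deltaWeakStar f

/-! Let `φ` be in the bidual ball, with `φ (F k) > d` for a bounded sequence of functionals. Helly's
theorem gives `y n` in the unit ball with `F k (y n) > d` for all `k ≤ n`; one `x` must nearly do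
the job of `y k` for infinitely many `k`. The variations `|F k|` are absolutely continuous with
respect to one positive functional `ν`. Choosing `y n` almost minimal for `ν (y * y)` makes the
sequence eventually `L²(ν)`-close to a fixed `y n₀`, so `y n` differs noticeably from `y n₀` only on
a `ν`-small set. The mass that `|F k|` can place on `ν`-small sets has a critical level `h` along an
ultrafilter, and almost all of it is captured by disjoint sets (`exists_disjoint_concentration`).
Rosenthal's lemma makes each selected `|F k|` nearly vanish on the sets belonging to the other
indices. Gluing `y k` on the set of index `k`, and `y n₀` elsewhere, gives `x`. No factor is lost,
hence the constant 1. -/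

open Filter Function Set

/-! ### Finitely additive contents and Rosenthal's lemma -/

/-- A nonnegative real-valued finitely additive set function defined on all subsets. -/
structure IsFinAddContent {Γ : Type*} (m : Set Γ → ℝ) : Prop where
  nonneg : ∀ A, 0 ≤ m A
  union : ∀ A B, Disjoint A B → m (A ∪ B) = m A + m B

namespace IsFinAddContent

variable {Γ : Type*} {m : Set Γ → ℝ}

theorem empty (hm : IsFinAddContent m) : m ∅ = 0 := by
  have := hm.union ∅ ∅ (by simp)
  simpa using this

theorem mono (hm : IsFinAddContent m) {A B : Set Γ} (h : A ⊆ B) : m A ≤ m B := by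
  have := hm.union A (B \ A) disjoint_sdiff_right
  rw [union_sdiff_cancel h] at this
  linarith [hm.nonneg (B \ A)]

theorem le_diff_add (hm : IsFinAddContent m) (A B : Set Γ) : m A ≤ m (A \ B) + m B := by
  have := hm.union (A \ B) B disjoint_sdiff_left
  rw [← this]
  exact hm.mono (by simp)

theorem biUnion_le {ι : Type*} (hm : IsFinAddContent m) (s : Finset ι) (A : ι → Set Γ) :
    m (⋃ i ∈ s, A i) ≤ ∑ i ∈ s, m (A i) := by
  classical
  induction s using Finset.induction_on with
  | empty => simp [hm.empty]
  | insert a s ha ih =>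
    rw [Finset.set_biUnion_insert, Finset.sum_insert ha]
    have h1 := hm.le_diff_add (A a ∪ ⋃ i ∈ s, A i) (⋃ i ∈ s, A i)
    have h2 : m ((A a ∪ ⋃ i ∈ s, A i) \ ⋃ i ∈ s, A i) ≤ m (A a) := hm.mono (by simp)
    linarith

theorem biUnion_eq {ι : Type*} (hm : IsFinAddContent m) (s : Finset ι) (A : ι → Set Γ)
    (hA : (s : Set ι).PairwiseDisjoint A) :
    m (⋃ i ∈ s, A i) = ∑ i ∈ s, m (A i) := by
  classical
  induction s using Finset.induction_on with
  | empty => simp [hm.empty]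
  | insert a s ha ih =>
    rw [Finset.set_biUnion_insert, Finset.sum_insert ha, hm.union, ih]
    · exact hA.subset (by simp)
    · simp only [disjoint_iUnion_right]
      intro i hi
      exact hA (by simp) (by simp [hi]) (by rintro rfl; exact ha hi)

end IsFinAddContent

/-- **Rosenthal's disjointness lemma** for sequences of finitely additive set functions. -/
theorem exists_injective_content_iUnion_le {Γ : Type*} {ε : ℝ} (n : ℕ) :
    ∀ (m : ℕ → Set Γ → ℝ) (A : ℕ → Set Γ), (∀ k, IsFinAddContent (m k)) →
      Pairwise (Disjoint on A) → (∀ k, m k (⋃ i, A i) ≤ n * ε) → 0 ≤ ε →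
      ∃ σ : ℕ → ℕ, Injective σ ∧ ∀ j, m (σ j) (⋃ i ∈ {i | i ≠ j}, A (σ i)) ≤ ε := by
  induction n with
  | zero =>
    intro m A hm _ h hε
    refine ⟨id, injective_id, fun j => ?_⟩
    have h1 := h j
    have h2 : m j (⋃ i ∈ {i | i ≠ j}, A i) ≤ m j (⋃ i, A i) :=
      (hm j).mono (iUnion₂_subset fun i _ => subset_iUnion A i)
    simp only [Nat.cast_zero, zero_mul] at h1
    exact h2.trans (h1.trans hε)
  | succ n ih =>
    intro m A hm hA h hε
    -- Pairing splits `ℕ` into infinitely many rows. If no row works, each row `p` has an index `u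
    -- p` whose content gives the rest of its row mass more than `ε`. The chosen sets avoid that
    -- rest, so their union has mass at most `(n + 1) * ε - ε`.
    by_cases hp : ∃ p, ∀ j, m (Nat.pair p j) (⋃ i ∈ {i | i ≠ j}, A (Nat.pair p i)) ≤ ε
    · obtain ⟨p, hp⟩ := hp
      exact ⟨Nat.pair p, fun a b hab => (Nat.pair_eq_pair.1 hab).2, hp⟩
    push Not at hp
    choose u hu using hp
    have hτ : Injective fun p => Nat.pair p (u p) := fun a b hab => (Nat.pair_eq_pair.1 hab).1
    obtain ⟨σ, hσ, hσ'⟩ := ih (fun p => m (Nat.pair p (u p))) (fun p => A (Nat.pair p (u p)))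
      (fun p => hm _) (fun a b hab => hA (hτ.ne hab)) (fun p => by
        have hd : Disjoint (⋃ q, A (Nat.pair q (u q)))
            (⋃ i ∈ {i | i ≠ u p}, A (Nat.pair p i)) := by
          simp only [disjoint_iUnion_right, disjoint_iUnion_left]
          intro i hi q
          refine hA fun hq => hi ?_
          obtain ⟨rfl, h2⟩ := Nat.pair_eq_pair.1 hq
          exact h2.symm
        have h1 := (hm (Nat.pair p (u p))).union _ _ hd
        have h2 : m (Nat.pair p (u p)) ((⋃ q, A (Nat.pair q (u q))) ∪
            (⋃ i ∈ {i | i ≠ u p}, A (Nat.pair p i))) ≤ m (Nat.pair p (u p)) (⋃ i, A i) :=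
          (hm _).mono (union_subset (iUnion_subset fun q => subset_iUnion A _)
            (iUnion₂_subset fun i _ => subset_iUnion A _))
        have h3 := h (Nat.pair p (u p))
        have h4 := hu p
        push_cast at h3
        linarith) hε
    exact ⟨fun j => Nat.pair (σ j) (u (σ j)), hτ.comp hσ, hσ'⟩

/-! ### Disjoint sets carrying the concentrated mass -/

section Concentration

variable {Γ : Type*} {m : ℕ → Set Γ → ℝ} {ν : Set Γ → ℝ} {C h δ₀ ε : ℝ}

/-- Among `N > C / η` disjoint candidates, one must be `η`-small for ultrafilter-many contents:
otherwise a single content would exceed `η` on all of them and have total mass at least `N * η > C`.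
-/
theorem exists_concentration_of_eventually (hm : ∀ k, IsFinAddContent (m k))
    (hC : ∀ k, m k univ ≤ C) (hν : Monotone ν)
    (hac : ∀ k, ∀ ε > 0, ∀ᶠ δ in nhdsWithin (0 : ℝ) (Ioi 0), ∀ S, ν S ≤ δ → m k S ≤ ε)
    (hS : ∀ δ > 0, ∀ᶠ k in hyperfilter ℕ, ∃ S, ν S ≤ δ ∧ h ≤ m k S)
    (hδ₀ : 0 < δ₀) (hε : 0 < ε) {η : ℝ} (hη : 0 < η) {T : ℕ → Prop}
    (hT : ∀ᶠ k in hyperfilter ℕ, T k) :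
    ∃ k A, T k ∧ ν A ≤ δ₀ ∧ h - ε ≤ m k A ∧ ∀ᶠ l in hyperfilter ℕ, m l A < η := by
  classical
  obtain ⟨N, hN⟩ := exists_nat_gt (max (C / η) 0)
  have hN0 : (0 : ℝ) < N := (le_max_right _ _).trans_lt hN
  have hNC : C < N * η := (div_lt_iff₀ hη).1 ((le_max_left _ _).trans_lt hN)
  obtain ⟨f, hf, hfr⟩ := exists_seq_of_forall_finset_exists
    (fun p : ℕ × Set Γ => T p.1 ∧ ν p.2 ≤ δ₀ ∧ h ≤ m p.1 p.2)
    (fun p q => m p.1 q.2 ≤ ε / N) (fun s _ => by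
      have h1 : ∀ᶠ δ in nhdsWithin (0 : ℝ) (Ioi 0),
          ∀ p ∈ s, ∀ S, ν S ≤ δ → m p.1 S ≤ ε / N :=
        (Filter.eventually_all_finset s).2 fun p _ => hac p.1 _ (by positivity)
      have h2 : ∀ᶠ δ in nhdsWithin (0 : ℝ) (Ioi 0), δ ∈ Ioo 0 δ₀ :=
        Ioo_mem_nhdsGT hδ₀
      obtain ⟨δ, h3, h4⟩ := (h1.and h2).exists
      obtain ⟨k, hk, S, hS1, hS2⟩ := (hT.and (hS δ h4.1)).exists
      exact ⟨(k, S), ⟨hk, hS1.trans h4.2.le, hS2⟩, fun p hp => h3 p hp S hS1⟩)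
  -- Later sets were chosen so `ν`-small that each earlier content gives them at most `ε / N`;
  -- removing fewer than `N` of them costs at most `ε`.
  set V : ℕ → Set Γ := fun i => (f i).2 \ ⋃ j ∈ Finset.Ioo i N, (f j).2 with hV
  have hVm : ∀ i, h - ε ≤ m (f i).1 (V i) := by
    intro i
    have h1 := (hm (f i).1).le_diff_add (f i).2 (⋃ j ∈ Finset.Ioo i N, (f j).2)
    have h2 := (hm (f i).1).biUnion_le (Finset.Ioo i N) (fun j => (f j).2)
    have h3 : ∑ j ∈ Finset.Ioo i N, m (f i).1 (f j).2 ≤ ∑ j ∈ Finset.Ioo i N, ε / N :=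
      Finset.sum_le_sum fun j hj => hfr i j (Finset.mem_Ioo.1 hj).1
    have h4 : ∑ j ∈ Finset.Ioo i N, ε / N ≤ ε := by
      rw [Finset.sum_const, nsmul_eq_mul, mul_div_assoc', div_le_iff₀ hN0, mul_comm]
      gcongr
      rw [Nat.card_Ioo]
      omega
    have h5 := (hf i).2.2
    simp only [hV]
    linarith
  have hVd : ((Finset.range N : Finset ℕ) : Set ℕ).PairwiseDisjoint V := by
    have key : ∀ i j, i < j → j < N → Disjoint (V i) (V j) := by
      intro i j hij hj
      refine Set.disjoint_left.2 fun x hx hx' => hx.2 ?_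
      simp only [mem_iUnion]
      exact ⟨j, Finset.mem_Ioo.2 ⟨hij, hj⟩, hx'.1⟩
    intro i hi j hj hij
    rcases lt_or_gt_of_ne hij with h1 | h1
    · exact key i j h1 (by simpa using hj)
    · exact (key j i h1 (by simpa using hi)).symm
  suffices h1 : ∃ i ∈ Finset.range N, ∀ᶠ l in hyperfilter ℕ, m l (V i) < η by
    obtain ⟨i, -, hi⟩ := h1
    exact ⟨(f i).1, V i, (hf i).1, (hν sdiff_subset).trans (hf i).2.1, hVm i, hi⟩
  by_contra hcon
  push Not at hcon
  have h2 : ∀ᶠ l in hyperfilter ℕ, ∀ i ∈ Finset.range N, η ≤ m l (V i) :=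
    (Filter.eventually_all_finset _).2 hcon
  obtain ⟨l, hl⟩ := h2.exists
  have h3 := (hm l).biUnion_eq _ V hVd
  have h4 := Finset.sum_le_sum hl
  have h5 := (hm l).mono (subset_univ (⋃ i ∈ Finset.range N, V i))
  simp only [Finset.sum_const, Finset.card_range, nsmul_eq_mul] at h4
  linarith [hC l]

/-- Each chosen set is nearly null for the later contents, so it can be removed from the later sets.
The loss `3 * ε` is `ε` from the previous lemma plus a geometric series of sum at most `2 * ε`. -/
theorem exists_disjoint_concentration (hm : ∀ k, IsFinAddContent (m k))
    (hC : ∀ k, m k univ ≤ C) (hν : Monotone ν)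
    (hac : ∀ k, ∀ ε > 0, ∀ᶠ δ in nhdsWithin (0 : ℝ) (Ioi 0), ∀ S, ν S ≤ δ → m k S ≤ ε)
    (hS : ∀ δ > 0, ∀ᶠ k in hyperfilter ℕ, ∃ S, ν S ≤ δ ∧ h ≤ m k S)
    (hδ₀ : 0 < δ₀) (hε : 0 < ε) {Q : ℕ → Prop} (hQ : ∀ᶠ k in hyperfilter ℕ, Q k) :
    ∃ (k : ℕ → ℕ) (A : ℕ → Set Γ), StrictMono k ∧ Pairwise (Disjoint on A) ∧
      ∀ i, Q (k i) ∧ ν (A i) ≤ δ₀ ∧ h - 3 * ε ≤ m (k i) (A i) := by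
  classical
  obtain ⟨f, hf, hfr⟩ := exists_seq_of_forall_finset_exists
    (fun p : ℕ × Set Γ × ℕ => Q p.1 ∧ ν p.2.1 ≤ δ₀ ∧ h - ε ≤ m p.1 p.2.1 ∧
      ∀ᶠ l in hyperfilter ℕ, m l p.2.1 < ε * (1 / 2) ^ p.2.2)
    (fun p q => p.1 < q.1 ∧ p.2.2 < q.2.2 ∧ m q.1 p.2.1 < ε * (1 / 2) ^ p.2.2) (fun s hs => by
      have h1 : ∀ᶠ k in hyperfilter ℕ, Q k ∧ ∀ p ∈ s, p.1 < k ∧ m k p.2.1 < ε * (1 / 2) ^ p.2.2 := by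
        refine hQ.and ((Filter.eventually_all_finset s).2 fun p hp => ?_)
        refine Eventually.and ?_ (hs p hp).2.2.2
        exact Filter.Eventually.filter_mono (Nat.hyperfilter_le_atTop) (eventually_gt_atTop p.1)
      obtain ⟨k, A, hk, hA, hkA, hl⟩ := exists_concentration_of_eventually hm hC hν hac hS hδ₀ hε
        (η := ε * (1 / 2) ^ (s.sup (fun p => p.2.2) + 1)) (by positivity) h1
      refine ⟨(k, A, s.sup (fun p => p.2.2) + 1), ⟨hk.1, hA, hkA, hl⟩, fun p hp =>
        ⟨(hk.2 p hp).1, ?_, (hk.2 p hp).2⟩⟩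
      exact Nat.lt_succ_of_le (Finset.le_sup (f := fun p : ℕ × Set Γ × ℕ => p.2.2) hp))
  have ht : StrictMono fun i => (f i).2.2 := fun i j hij => (hfr i j hij).2.1
  refine ⟨fun i => (f i).1, disjointed fun i => (f i).2.1, fun i j hij => (hfr i j hij).1,
    disjoint_disjointed _, fun i => ⟨(hf i).1, (hν (disjointed_subset _ _)).trans (hf i).2.1, ?_⟩⟩
  have h1 := (hm (f i).1).le_diff_add (f i).2.1 (⋃ j ∈ Finset.range i, (f j).2.1)
  have h2 := (hm (f i).1).biUnion_le (Finset.range i) (fun j => (f j).2.1)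
  have h3 : ∑ j ∈ Finset.range i, m (f i).1 (f j).2.1 ≤
      ∑ j ∈ Finset.range i, ε * (1 / 2) ^ j := by
    refine Finset.sum_le_sum fun j hj => ?_
    refine (hfr j i (Finset.mem_range.1 hj)).2.2.le.trans ?_
    gcongr ε * ?_
    exact pow_le_pow_of_le_one (by norm_num) (by norm_num) (ht.le_apply)
  have h4 : ∑ j ∈ Finset.range i, ε * (1 / 2 : ℝ) ^ j ≤ ε * 2 := by
    rw [← Finset.mul_sum]
    gcongr
    exact sum_geometric_two_le i
  have h5 := (hf i).2.2.1
  have h6 : disjointed (fun i => (f i).2.1) i =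
      (f i).2.1 \ ⋃ j ∈ Finset.range i, (f j).2.1 := by
    rw [disjointed_apply, Finset.sup_set_eq_biUnion]
    congr 2
    ext
    simp
  rw [h6]
  linarith

end Concentration

/-! ### Helly's theorem -/

/-- Otherwise some `g` separates the image of the ball from the open orthant above `d`, at a level
`u ≤ 0`. By symmetry of the ball `g ∘ T` has norm at most `-u`, yet `φ` takes a value below `u` on
it. -/
theorem exists_mem_closedBall_forall_lt {X : Type*} [NormedAddCommGroup X] [NormedSpace ℝ X]
    {φ : StrongDual ℝ (StrongDual ℝ X)} (hφ : ‖φ‖ ≤ 1) {ι : Type*} [Fintype ι]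
    (F : ι → StrongDual ℝ X) {d : ℝ} (h : ∀ i, d < φ (F i)) :
    ∃ y : X, ‖y‖ ≤ 1 ∧ ∀ i, d < F i y := by
  classical
  by_contra hcon
  push Not at hcon
  let U : Set (ι → ℝ) := Set.pi univ fun _ => Ioi d
  let T : X →L[ℝ] (ι → ℝ) := ContinuousLinearMap.pi F
  have hdisj : Disjoint U (T '' Metric.closedBall 0 1) := by
    rw [Set.disjoint_left]
    rintro _ hv ⟨y, hy, rfl⟩
    obtain ⟨i, hi⟩ := hcon y (by simpa using hy)
    exact absurd (hv i trivial) (by simpa [T] using hi)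
  obtain ⟨g, u, hgU, hgK⟩ := geometric_hahn_banach_open
    (convex_pi fun _ _ => convex_Ioi d) (isOpen_set_pi finite_univ fun _ _ => isOpen_Ioi)
    ((convex_closedBall (0 : X) 1).is_linear_image (f := T) T.isLinear) hdisj
  have hu : u ≤ 0 := by
    have := hgK (T 0) ⟨0, by simp, rfl⟩
    simpa using this
  have hG : ‖g.comp T‖ ≤ -u := by
    refine ContinuousLinearMap.opNorm_le_of_unit_norm (by linarith) fun y hy => ?_
    have h1 := hgK (T y) ⟨y, by simp [hy], rfl⟩
    have h2 := hgK (T (-y)) ⟨-y, by simp [hy], rfl⟩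
    rw [map_neg, map_neg] at h2
    rw [Real.norm_eq_abs, abs_le]
    simp only [ContinuousLinearMap.comp_apply]
    constructor <;> linarith
  have hsum : ∀ v : ι → ℝ, g v = ∑ i, v i * g (Pi.single i 1) := by
    intro v
    conv_lhs => rw [pi_eq_sum_univ' v]
    simp only [map_sum, map_smul, smul_eq_mul]
  have hφG : φ (g.comp T) = g fun i => φ (F i) := by
    have h1 : g.comp T = ∑ i, g (Pi.single i 1) • F i := by
      ext y
      rw [ContinuousLinearMap.comp_apply, hsum]
      simp [T, mul_comm]
    rw [h1, map_sum, hsum]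
    simp [mul_comm]
  have h1 := hgU (fun i => φ (F i)) fun i _ => h i
  have h2 : |φ (g.comp T)| ≤ -u :=
    (φ.le_of_opNorm_le hφ _).trans (by simpa using hG)
  rw [hφG] at h2
  linarith [neg_abs_le (g fun i => φ (F i))]

/-! ### Variation of functionals and positive additive functionals -/

section BoundedFunctions

variable {Γ : Type*}

/-- The bounded real functions on `Γ` with the supremum norm. -/
abbrev BddFun (Γ : Type*) := lp (fun _ : Γ => ℝ) ∞

namespace BddFun

/-- The element of `ℓ_∞(Γ)` given by a bounded function. -/
noncomputable def mk (f : Γ → ℝ) (C : ℝ) (h : ∀ γ, |f γ| ≤ C) : BddFun Γ :=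
  ⟨f, memℓp_infty ⟨C, by rintro _ ⟨γ, rfl⟩; exact h γ⟩⟩

@[simp] theorem mk_apply (f : Γ → ℝ) (C : ℝ) (h : ∀ γ, |f γ| ≤ C) (γ : Γ) : mk f C h γ = f γ := rfl

theorem norm_le {z : BddFun Γ} {C : ℝ} (hC : 0 ≤ C) (h : ∀ γ, |z γ| ≤ C) : ‖z‖ ≤ C :=
  lp.norm_le_of_forall_le hC h

theorem abs_apply_le (z : BddFun Γ) (γ : Γ) : |z γ| ≤ ‖z‖ :=
  lp.norm_apply_le_norm ENNReal.top_ne_zero z γ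

/-- The indicator function of a set. -/
noncomputable def ind (A : Set Γ) : BddFun Γ :=
  mk (A.indicator 1) 1 fun γ => by
    by_cases h : γ ∈ A <;> simp [h]

theorem ind_apply (A : Set Γ) (γ : Γ) : ind A γ = A.indicator 1 γ := rfl

theorem ind_apply_of_mem {A : Set Γ} {γ : Γ} (h : γ ∈ A) : ind A γ = 1 := by
  simp [ind_apply, h]

theorem ind_apply_of_notMem {A : Set Γ} {γ : Γ} (h : γ ∉ A) : ind A γ = 0 := by
  simp [ind_apply, h]

theorem ind_nonneg (A : Set Γ) (γ : Γ) : 0 ≤ ind A γ := by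
  by_cases h : γ ∈ A <;> simp [ind_apply, h]

theorem norm_ind_le (A : Set Γ) : ‖ind A‖ ≤ 1 :=
  norm_le zero_le_one fun γ => by by_cases h : γ ∈ A <;> simp [ind_apply, h]

theorem ind_union {A B : Set Γ} (h : Disjoint A B) : ind (A ∪ B) = ind A + ind B := by
  ext γ
  simp only [lp.coeFn_add, Pi.add_apply, ind_apply]
  rw [Set.indicator_union_of_disjoint h]

theorem exists_eq_mul_of_abs_le {w z : BddFun Γ} (h : ∀ γ, |w γ| ≤ z γ) :
    ∃ s : BddFun Γ, ‖s‖ ≤ 1 ∧ w = z * s := by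
  have hs : ∀ γ, |w γ / z γ| ≤ 1 := fun γ => by
    rw [abs_div]
    exact div_le_one_of_le₀ ((h γ).trans (le_abs_self _)) (abs_nonneg _)
  refine ⟨mk (fun γ => w γ / z γ) 1 hs, norm_le zero_le_one hs, ?_⟩
  ext γ
  rw [lp.infty_coeFn_mul, Pi.mul_apply, mk_apply]
  by_cases hz : z γ = 0
  · have := h γ
    rw [hz] at this ⊢
    simpa using abs_nonpos_iff.1 this
  · field_simp

/-- The value of the variation `|F|` of a functional `F` at a nonnegative function. -/
noncomputable def variation (F : StrongDual ℝ (BddFun Γ)) (z : BddFun Γ) : ℝ :=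
  ‖F.comp (ContinuousLinearMap.mul ℝ (BddFun Γ) z)‖

variable (F : StrongDual ℝ (BddFun Γ))

theorem variation_nonneg (z : BddFun Γ) : 0 ≤ variation F z := norm_nonneg _

theorem variation_le (z : BddFun Γ) : variation F z ≤ ‖F‖ * ‖z‖ :=
  (ContinuousLinearMap.opNorm_comp_le _ _).trans
    (mul_le_mul_of_nonneg_left (ContinuousLinearMap.opNorm_mul_apply_le ℝ (BddFun Γ) z)
      (norm_nonneg _))

theorem variation_smul {c : ℝ} (hc : 0 ≤ c) (z : BddFun Γ) :
    variation F (c • z) = c * variation F z := by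
  rw [variation, map_smul, ContinuousLinearMap.comp_smul, norm_smul, Real.norm_of_nonneg hc,
    variation]

theorem abs_le_variation {w z : BddFun Γ} (h : ∀ γ, |w γ| ≤ z γ) : |F w| ≤ variation F z := by
  obtain ⟨s, hs, rfl⟩ := exists_eq_mul_of_abs_le h
  exact (F.comp (ContinuousLinearMap.mul ℝ (BddFun Γ) z)).le_of_opNorm_le_of_le le_rfl hs |>.trans
    (by simp [variation])

theorem variation_le_of_forall {z : BddFun Γ} (hz : ∀ γ, 0 ≤ z γ) {c : ℝ}
    (h : ∀ w : BddFun Γ, (∀ γ, |w γ| ≤ z γ) → F w ≤ c) : variation F z ≤ c := by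
  have key : ∀ s : BddFun Γ, ‖s‖ ≤ 1 → F (z * s) ≤ c := fun s hs => h _ fun γ => by
    rw [lp.infty_coeFn_mul, Pi.mul_apply, abs_mul, abs_of_nonneg (hz γ)]
    exact mul_le_of_le_one_right (hz γ) ((abs_apply_le s γ).trans hs)
  refine ContinuousLinearMap.opNorm_le_of_unit_norm ?_ fun s hs => ?_
  · simpa using h 0 (by simpa using hz)
  · have h1 := key s hs.le
    have h2 := key (-s) (by rw [norm_neg]; exact hs.le)
    rw [show z * -s = -(z * s) from mul_neg z s, map_neg] at h2
    rw [Real.norm_eq_abs, abs_le]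
    simp only [ContinuousLinearMap.comp_apply, ContinuousLinearMap.mul_apply']
    constructor <;> linarith

/-- For superadditivity, `|w| ≤ z` and `|w'| ≤ z'` give `|w + w'| ≤ z + z'`, and the variation is
the supremum of `F` over such an order interval. -/
theorem variation_add {z z' : BddFun Γ} (hz : ∀ γ, 0 ≤ z γ) (hz' : ∀ γ, 0 ≤ z' γ) :
    variation F (z + z') = variation F z + variation F z' := by
  refine le_antisymm ?_ ?_
  · simp only [variation, map_add, ContinuousLinearMap.comp_add]
    exact norm_add_le _ _
  · rw [← le_sub_iff_add_le]
    refine variation_le_of_forall F hz fun w hw => ?_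
    rw [le_sub_comm]
    refine variation_le_of_forall F hz' fun w' hw' => ?_
    rw [le_sub_iff_add_le, ← map_add]
    refine (le_abs_self _).trans (abs_le_variation F fun γ => ?_)
    simp only [lp.coeFn_add, Pi.add_apply]
    linarith [abs_add_le (w' γ) (w γ), hw γ, hw' γ]

theorem isFinAddContent_variation : IsFinAddContent fun A : Set Γ => variation F (ind A) where
  nonneg A := variation_nonneg F _
  union A B h := by rw [ind_union h, variation_add F (ind_nonneg A) (ind_nonneg B)]

/-- A nonnegative additive functional on the cone of nonnegative bounded functions. -/
structure IsPosAdditive (ν : BddFun Γ → ℝ) : Prop where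
  nonneg : ∀ z, 0 ≤ ν z
  add : ∀ z z' : BddFun Γ, (∀ γ, 0 ≤ z γ) → (∀ γ, 0 ≤ z' γ) → ν (z + z') = ν z + ν z'
  smul : ∀ (c : ℝ) (z : BddFun Γ), 0 ≤ c → ν (c • z) = c * ν z

namespace IsPosAdditive

variable {ν : BddFun Γ → ℝ}

theorem mono (hν : IsPosAdditive ν) {z z' : BddFun Γ} (hz : ∀ γ, 0 ≤ z γ)
    (h : ∀ γ, z γ ≤ z' γ) : ν z ≤ ν z' := by
  have h1 := hν.add z (z' - z) hz fun γ => by simpa using h γ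
  rw [add_sub_cancel] at h1
  linarith [hν.nonneg (z' - z)]

theorem mul_ind_le (hν : IsPosAdditive ν) {z : BddFun Γ} (hz : ∀ γ, 0 ≤ z γ) {c : ℝ}
    (hc : 0 ≤ c) {A : Set Γ} (hA : ∀ γ ∈ A, c ≤ z γ) : c * ν (ind A) ≤ ν z := by
  rw [← hν.smul c _ hc]
  refine hν.mono (fun γ => ?_) fun γ => ?_
  · simpa using mul_nonneg hc (ind_nonneg A γ)
  · by_cases h : γ ∈ A
    · simpa [ind_apply_of_mem h] using hA γ h
    · simpa [ind_apply_of_notMem h] using hz γ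

theorem isFinAddContent (hν : IsPosAdditive ν) : IsFinAddContent fun A : Set Γ => ν (ind A) where
  nonneg A := hν.nonneg _
  union A B h := by rw [ind_union h, hν.add _ _ (ind_nonneg A) (ind_nonneg B)]

/-- Arranged as sums of squares with nonnegative coefficients, since `ν` is additive only on the
positive cone. -/
theorem parallelogram (hν : IsPosAdditive ν) (y y' : BddFun Γ) :
    ν ((y - y') * (y - y')) + 4 * ν (((1 / 2 : ℝ) • (y + y')) * ((1 / 2 : ℝ) • (y + y'))) =
      2 * ν (y * y) + 2 * ν (y' * y') := by
  have hsq : ∀ (z : BddFun Γ) γ, 0 ≤ (z * z) γ := fun z γ => by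
    simpa using mul_self_nonneg (z γ)
  have hc : ∀ (c : ℝ) (z : BddFun Γ) γ, 0 ≤ c → 0 ≤ (c • (z * z)) γ := fun c z γ hc => by
    simpa using mul_nonneg hc (hsq z γ)
  rw [← hν.smul _ _ (by norm_num : (0 : ℝ) ≤ 4), ← hν.smul _ _ (by norm_num : (0 : ℝ) ≤ 2),
    ← hν.smul _ _ (by norm_num : (0 : ℝ) ≤ 2), ← hν.add _ _ (hsq _) fun γ => hc _ _ γ (by norm_num),
    ← hν.add _ _ (fun γ => hc _ _ γ (by norm_num)) fun γ => hc _ _ γ (by norm_num)]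
  congr 1
  ext γ
  simp only [lp.coeFn_add, lp.coeFn_sub, lp.coeFn_smul, lp.infty_coeFn_mul, Pi.add_apply,
    Pi.sub_apply, Pi.smul_apply, Pi.mul_apply, smul_eq_mul]
  ring

/-- Almost-minimizers of the quadratic form of `ν` in a decreasing sequence of convex sets of
bounded functions form a Cauchy sequence. -/
theorem exists_seq_mem_forall_lt (hν : IsPosAdditive ν) {K : ℕ → Set (BddFun Γ)}
    (hKc : ∀ n, Convex ℝ (K n)) (hKn : ∀ n, (K n).Nonempty) (hK : Antitone K) {R : ℝ}
    (hR : ∀ n, ∀ y ∈ K n, ν (y * y) ≤ R) {ε : ℝ} (hε : 0 < ε) :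
    ∃ (n₀ : ℕ) (y : ℕ → BddFun Γ), (∀ n, y n ∈ K n) ∧
      ∀ n ≥ n₀, ν ((y n₀ - y n) * (y n₀ - y n)) < ε := by
  have hne : ∀ n, ((fun y => ν (y * y)) '' K n).Nonempty := fun n => (hKn n).image _
  have hbdd : ∀ n, BddBelow ((fun y => ν (y * y)) '' K n) := fun n =>
    ⟨0, by rintro _ ⟨y, -, rfl⟩; exact hν.nonneg _⟩
  set r : ℕ → ℝ := fun n => sInf ((fun y => ν (y * y)) '' K n) with hr
  have hrle : ∀ n, ∀ y ∈ K n, r n ≤ ν (y * y) := fun n y hy => csInf_le (hbdd n) ⟨y, hy, rfl⟩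
  have hrm : Monotone r := fun i j hij => csInf_le_csInf (hbdd i) (hne j) (image_mono (hK hij))
  have hrR : BddAbove (range r) := ⟨R, by
    rintro _ ⟨n, rfl⟩
    obtain ⟨y, hy⟩ := hKn n
    exact (hrle n y hy).trans (hR n y hy)⟩
  have hy : ∀ n, ∃ y ∈ K n, ν (y * y) < r n + ε / 8 := fun n => by
    obtain ⟨_, ⟨y, hy, rfl⟩, h⟩ := exists_lt_of_csInf_lt (hne n)
      (show sInf ((fun y => ν (y * y)) '' K n) < r n + ε / 8 by simp only [hr]; linarith)
    exact ⟨y, hy, h⟩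
  choose y hyK hyr using hy
  obtain ⟨n₀, hn₀⟩ := exists_lt_of_lt_ciSup (show (⨆ n, r n) - ε / 8 < ⨆ n, r n by linarith)
  refine ⟨n₀, y, hyK, fun n hn => ?_⟩
  -- The midpoint lies in `K n₀`, so its form is at least `r n₀`; the parallelogram law leaves at
  -- most `2 * (r n - r n₀) + ε / 2`, below `3 * ε / 4`.
  have h1 := hν.parallelogram (y n₀) (y n)
  have h2 := hrle n₀ ((1 / 2 : ℝ) • (y n₀ + y n)) (by
    rw [smul_add]
    exact hKc n₀ (hyK n₀) (hK hn (hyK n)) (by norm_num) (by norm_num) (by norm_num))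
  have h3 := hyr n₀
  have h4 := hyr n
  have h5 := le_ciSup hrR n
  linarith

end IsPosAdditive

/-- A positive functional with respect to which the variations of all members of a bounded
sequence of functionals are absolutely continuous. -/
theorem exists_isPosAdditive_control (F : ℕ → StrongDual ℝ (BddFun Γ)) {C : ℝ}
    (hF : ∀ k, ‖F k‖ ≤ C) :
    ∃ ν : BddFun Γ → ℝ, IsPosAdditive ν ∧ (∀ z, ν z ≤ 2 * C * ‖z‖) ∧
      ∀ k z, variation (F k) z ≤ 2 ^ k * ν z := by
  have hle : ∀ z k, (1 / 2 : ℝ) ^ k * variation (F k) z ≤ (1 / 2 : ℝ) ^ k * (C * ‖z‖) :=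
    fun z k => by
      gcongr
      exact (variation_le (F k) z).trans (by gcongr; exact hF k)
  have h0 : ∀ z k, 0 ≤ (1 / 2 : ℝ) ^ k * variation (F k) z := fun z k =>
    mul_nonneg (by positivity) (variation_nonneg _ _)
  have hgeo : ∀ z : BddFun Γ, Summable fun k : ℕ => (1 / 2 : ℝ) ^ k * (C * ‖z‖) := fun z =>
    summable_geometric_two.mul_right _
  have hs : ∀ z, Summable fun k => (1 / 2 : ℝ) ^ k * variation (F k) z := fun z =>
    Summable.of_nonneg_of_le (h0 z) (hle z) (hgeo z)
  refine ⟨fun z => ∑' k, (1 / 2 : ℝ) ^ k * variation (F k) z,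
    ⟨fun z => tsum_nonneg (h0 z), fun z z' hz hz' => ?_, fun c z hc => ?_⟩, fun z => ?_,
    fun k z => ?_⟩
  · rw [← (hs z).tsum_add (hs z')]
    simp only [variation_add _ hz hz', mul_add]
  · rw [← tsum_mul_left]
    simp only [variation_smul _ hc, mul_left_comm]
  · refine ((hs z).tsum_le_tsum (hle z) (hgeo z)).trans_eq ?_
    rw [tsum_mul_right, tsum_geometric_two, mul_assoc]
  · have h1 := (hs z).le_tsum k fun j _ => h0 z j
    calc variation (F k) z = 2 ^ k * ((1 / 2 : ℝ) ^ k * variation (F k) z) := by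
          rw [← mul_assoc, ← mul_pow]; norm_num
      _ ≤ _ := by gcongr

end BddFun

end BoundedFunctions

/-! ### Gluing almost-minimizers along the concentration sets -/

section Grothendieck

variable {Γ : Type*}

namespace BddFun

/-- The critical level of concentration of the contents `m k` on `ν`-small sets, up to `ε`. -/
theorem exists_concentration_level {m : ℕ → Set Γ → ℝ} {ν : Set Γ → ℝ} {C ε : ℝ}
    (hm : ∀ k, IsFinAddContent (m k)) (hν : IsFinAddContent ν) (hC : ∀ k, m k univ ≤ C)
    (hε : 0 < ε) :
    ∃ h : ℝ, (∀ δ > 0, ∀ᶠ k in hyperfilter ℕ, ∃ S, ν S ≤ δ ∧ h ≤ m k S) ∧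
      ∃ δ > 0, ∀ᶠ k in hyperfilter ℕ, ∀ S, ν S ≤ δ → m k S < h + ε := by
  by_contra hcon
  push Not at hcon
  -- For an ultrafilter, failure of the upper bound means that the level `h + ε` is also attained.
  -- Levels would then climb past `C`.
  have key : ∀ n : ℕ, ∀ δ > 0, ∀ᶠ k in hyperfilter ℕ, ∃ S, ν S ≤ δ ∧ n * ε ≤ m k S := by
    intro n
    induction n with
    | zero =>
      exact fun δ hδ => Eventually.of_forall fun k =>
        ⟨∅, by rw [hν.empty]; exact hδ.le, by simpa using (hm k).nonneg ∅⟩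
    | succ n ih =>
      intro δ hδ
      have h1 := hcon _ ih δ hδ
      push_cast
      simpa only [add_mul, one_mul] using h1
  obtain ⟨n, hn⟩ := exists_nat_gt (C / ε)
  obtain ⟨k, S, -, hk⟩ := (key n 1 one_pos).exists
  have h1 := (hm k).mono (subset_univ S)
  have h2 := hC k
  rw [div_lt_iff₀ hε] at hn
  linarith

/-- A bounded function glued from `y` off the disjoint sets `B j` and `z j` on `B j`. -/
theorem exists_glue {B : ℕ → Set Γ} (hB : Pairwise (Disjoint on B)) (y : BddFun Γ)
    (z : ℕ → BddFun Γ) (hy : ‖y‖ ≤ 1) (hz : ∀ j, ‖z j‖ ≤ 1) :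
    ∃ x : BddFun Γ, ‖x‖ ≤ 1 ∧ (∀ j, ∀ γ ∈ B j, x γ = z j γ) ∧
      ∀ γ, (∀ j, γ ∉ B j) → x γ = y γ := by
  classical
  let f : Γ → ℝ := fun γ => if h : ∃ j, γ ∈ B j then z h.choose γ else y γ
  have hf : ∀ γ, |f γ| ≤ 1 := fun γ => by
    by_cases h : ∃ j, γ ∈ B j
    · simpa only [f, dif_pos h] using (abs_apply_le _ γ).trans (hz _)
    · simpa only [f, dif_neg h] using (abs_apply_le _ γ).trans hy
  refine ⟨mk f 1 hf, norm_le zero_le_one hf, fun j γ hγ => ?_, fun γ hγ => ?_⟩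
  · have h : ∃ j, γ ∈ B j := ⟨j, hγ⟩
    have hj : h.choose = j := by
      by_contra hne
      exact Set.disjoint_left.1 (hB hne) h.choose_spec hγ
    rw [mk_apply]
    simp only [f, dif_pos h, hj]
  · rw [mk_apply]
    have h : ¬∃ j, γ ∈ B j := fun ⟨j, hj⟩ => hγ j hj
    simp only [f, dif_neg h]

theorem exists_frequently_lt {F : ℕ → StrongDual ℝ (BddFun Γ)} {C : ℝ} (hC : 0 < C)
    (hF : ∀ k, ‖F k‖ ≤ C) {φ : StrongDual ℝ (StrongDual ℝ (BddFun Γ))} (hφ : ‖φ‖ ≤ 1) {d : ℝ}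
    (hd : ∀ k, d < φ (F k)) {ε : ℝ} (hε : 0 < ε) :
    ∃ x : BddFun Γ, ‖x‖ ≤ 1 ∧ ∃ᶠ k in atTop, d - ε < F k x := by
  -- The final error is `e + 2 * (4 * e) + 2 * e`: off the exceptional sets, on `E \ B`, and on the
  -- other glued sets `U`.
  obtain ⟨e, he, heε⟩ : ∃ e > 0, 11 * e < ε := ⟨ε / 12, by positivity, by linarith⟩
  obtain ⟨ν, hν, hνC, hνF⟩ := exists_isPosAdditive_control F hF
  have hm : ∀ k, IsFinAddContent fun A : Set Γ => variation (F k) (ind A) := fun k =>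
    isFinAddContent_variation (F k)
  have hmC : ∀ k, variation (F k) (ind univ) ≤ C := fun k =>
    (variation_le _ _).trans ((mul_le_mul (hF k) (norm_ind_le _) (norm_nonneg _) hC.le).trans_eq
      (mul_one C))
  have hac : ∀ k, ∀ ε > 0, ∀ᶠ δ in nhdsWithin (0 : ℝ) (Ioi 0),
      ∀ S : Set Γ, ν (ind S) ≤ δ → variation (F k) (ind S) ≤ ε := by
    intro k ε hε
    have h1 : ∀ᶠ δ in nhdsWithin (0 : ℝ) (Ioi 0), δ ∈ Ioo 0 (ε / 2 ^ k) :=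
      Ioo_mem_nhdsGT (by positivity)
    refine h1.mono fun δ hδ S hS => (hνF k _).trans ?_
    rw [mul_comm, ← le_div_iff₀ (by positivity)]
    exact hS.trans hδ.2.le
  obtain ⟨h, hh, δ, hδ, hhδ⟩ := exists_concentration_level hm hν.isFinAddContent hmC he
  obtain ⟨n₀, y, hyK, hyc⟩ := hν.exists_seq_mem_forall_lt
    (K := fun n => {y | ‖y‖ ≤ 1 ∧ ∀ k ≤ n, d < F k y}) (R := 2 * C)
    (ε := (e / C) * (e / C) * (δ / 2))
    (fun n => by
      have h1 : {y : BddFun Γ | ‖y‖ ≤ 1 ∧ ∀ k ≤ n, d < F k y} =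
          Metric.closedBall 0 1 ∩ ⋂ k ≤ n, {y | d < F k y} := by
        ext y
        simp
      rw [h1]
      exact (convex_closedBall _ _).inter (convex_iInter₂ fun k _ =>
        convex_halfSpace_gt (F k).isLinear d))
    (fun n => by
      obtain ⟨y, hy, hy'⟩ := exists_mem_closedBall_forall_lt hφ
        (fun k : Fin (n + 1) => F k) fun k => hd k
      exact ⟨y, hy, fun k hk => hy' ⟨k, by omega⟩⟩)
    (fun i j hij y hy => ⟨hy.1, fun k hk => hy.2 k (hk.trans hij)⟩)
    (fun n y hy => (hνC _).trans (mul_le_of_le_one_right (by positivity)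
      ((norm_mul_le y y).trans (mul_le_one₀ hy.1 (norm_nonneg _) hy.1))))
    (by positivity)
  have hQ : ∀ᶠ k in hyperfilter ℕ, n₀ ≤ k ∧
      ∀ S : Set Γ, ν (ind S) ≤ δ → variation (F k) (ind S) < h + e :=
    ((eventually_ge_atTop n₀).filter_mono Nat.hyperfilter_le_atTop).and hhδ
  obtain ⟨k, A, hk, hA, hkA⟩ := exists_disjoint_concentration hm hmC
    (fun S T hST => hν.isFinAddContent.mono hST) hac hh (half_pos hδ) he hQ
  obtain ⟨N, hN⟩ := exists_nat_ge (C / e)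
  rw [div_le_iff₀ he] at hN
  obtain ⟨σ, hσ, hσA⟩ := exists_injective_content_iUnion_le N
    (fun i (S : Set Γ) => variation (F (k i)) (ind S)) A (fun i => hm _) hA
    (fun i => ((hm _).mono (subset_univ _)).trans ((hmC _).trans hN)) he.le
  obtain ⟨x, hx, hxB, hxy⟩ := exists_glue (B := fun j => A (σ j))
    (fun i j hij => hA (hσ.ne hij)) (y n₀) (fun j => y (k (σ j))) (hyK n₀).1 (fun j => (hyK _).1)
  refine ⟨x, hx, ?_⟩
  have hinj : Injective fun j => k (σ j) := hk.injective.comp hσ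
  have htend : Tendsto (fun j => k (σ j)) atTop atTop := by
    simpa only [Nat.cofinite_eq_atTop] using hinj.tendsto_cofinite
  refine htend.frequently (Frequently.of_forall fun j => ?_)
  obtain ⟨⟨hn₀, hsmall⟩, hνA, hAm⟩ := hkA (σ j)
  have hrest := hσA j
  set l := k (σ j) with hl
  set B := A (σ j) with hBdef
  set U : Set Γ := ⋃ i ∈ {i | i ≠ j}, A (σ i) with hU
  let E : Set Γ := {γ | e / C ≤ |y n₀ γ - y l γ|}
  -- Chebyshev's inequality; the tolerance `(e / C)² * (δ / 2)` for the almost-minimizers was fixed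
  -- for this.
  have hνE : ν (ind E) ≤ δ / 2 := by
    have h1 := hν.mul_ind_le (z := (y n₀ - y l) * (y n₀ - y l)) (c := e / C * (e / C)) (A := E)
      (fun γ => mul_self_nonneg (y n₀ γ - y l γ)) (by positivity)
      (fun γ hγ => by
        have h2 : e / C ≤ |y n₀ γ - y l γ| := hγ
        have h3 := mul_self_le_mul_self (by positivity) h2
        rwa [abs_mul_abs_self] at h3)
    exact le_of_mul_le_mul_left (h1.trans (hyc l hn₀).le) (by positivity)
  -- `E ∪ B` has `ν`-mass at most `δ`, hence variation below `h + e`, while `B` already carries at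
  -- least `h - 3 * e`.
  have hEB : variation (F l) (ind (E \ B)) ≤ 4 * e := by
    have h1 : ν (ind (E \ B ∪ B)) = ν (ind (E \ B)) + ν (ind B) :=
      hν.isFinAddContent.union (E \ B) B disjoint_sdiff_left
    have h2 : ν (ind (E \ B)) ≤ ν (ind E) := hν.isFinAddContent.mono sdiff_subset
    have h3 := hsmall ((E \ B) ∪ B) (by linarith)
    have h4 : variation (F l) (ind (E \ B ∪ B)) =
        variation (F l) (ind (E \ B)) + variation (F l) (ind B) :=
      (hm l).union (E \ B) B disjoint_sdiff_left
    linarith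
  have hbound : ∀ γ, |(x - y l) γ| ≤
      ((e / C) • ind univ + ((2 : ℝ) • ind (E \ B) + (2 : ℝ) • ind U) : BddFun Γ) γ := by
    intro γ
    have hyl : |y l γ| ≤ 1 := (abs_apply_le _ γ).trans (hyK l).1
    have hxl : |x γ| ≤ 1 := (abs_apply_le _ γ).trans hx
    have hab : |x γ - y l γ| ≤ 2 := (abs_sub _ _).trans (by linarith)
    have heC : 0 ≤ e / C := by positivity
    have i1 := ind_nonneg (E \ B) γ
    have i2 := ind_nonneg U γ
    simp only [lp.coeFn_add, lp.coeFn_sub, lp.coeFn_smul, Pi.add_apply, Pi.sub_apply,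
      Pi.smul_apply, smul_eq_mul, ind_apply_of_mem (mem_univ γ)]
    by_cases hU' : γ ∈ U
    · rw [ind_apply_of_mem hU']
      linarith
    by_cases hB' : γ ∈ B
    · rw [hxB j γ hB', sub_self, abs_zero]
      positivity
    have hxe : x γ = y n₀ γ := hxy γ fun i hi => by
      by_cases hij : i = j
      · subst hij
        exact hB' hi
      · exact hU' (mem_biUnion hij hi)
    by_cases hE : γ ∈ E
    · have h1 : ind (E \ B) γ = 1 := ind_apply_of_mem ⟨hE, hB'⟩
      linarith
    · have h1 : |y n₀ γ - y l γ| < e / C := not_le.1 hE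
      rw [hxe]
      linarith
  have h1 := abs_le_variation (F l) hbound
  have hp : ∀ (c : ℝ) (S : Set Γ) γ, 0 ≤ c → 0 ≤ (c • ind S : BddFun Γ) γ := fun c S γ hc => by
    simpa using mul_nonneg hc (ind_nonneg S γ)
  have heC : 0 ≤ e / C := by positivity
  rw [variation_add _ (fun γ => hp _ _ γ heC) (fun γ => add_nonneg (hp _ _ γ zero_le_two)
    (hp _ _ γ zero_le_two)), variation_add _ (fun γ => hp _ _ γ zero_le_two)
    (fun γ => hp _ _ γ zero_le_two), variation_smul _ heC, variation_smul _ zero_le_two,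
    variation_smul _ zero_le_two, map_sub] at h1
  have h2 : e / C * variation (F l) (ind univ) ≤ e := by
    rw [div_mul_eq_mul_div, div_le_iff₀ hC]
    gcongr
    exact hmC l
  have h3 := (hyK l).2 l le_rfl
  have h4 := neg_abs_le (F l x - F l (y l))
  linarith

end BddFun

end Grothendieck

/-! ### Reduction to differences of functionals -/

/-- To compare `deltaWeak` and `deltaWeakStar` it is enough to realize, up to `ε` and infinitely
often, uniform lower bounds of an element of the bidual ball on bounded sequences of functionals. -/
theorem deltaWeak_le_deltaWeakStar {X : Type*} [NormedAddCommGroup X] [NormedSpace ℝ X]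
    (H : ∀ (F : ℕ → StrongDual ℝ X) (C : ℝ), 0 < C → (∀ k, ‖F k‖ ≤ C) →
      ∀ φ : StrongDual ℝ (StrongDual ℝ X), ‖φ‖ ≤ 1 → ∀ d, (∀ k, d < φ (F k)) → ∀ ε > 0,
        ∃ x : X, ‖x‖ ≤ 1 ∧ ∃ᶠ k in atTop, d - ε < F k x)
    {f : ℕ → StrongDual ℝ X} (hf : Bornology.IsBounded (range f)) :
    deltaWeak f ≤ deltaWeakStar f := by
  refine iSup₂_le fun φ hφ => le_of_forall_lt fun c hc => ?_
  obtain ⟨b, hcb, hb⟩ := exists_between hc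
  have hb_top : b ≠ ⊤ := hb.ne_top
  obtain ⟨C, hC⟩ := hf.exists_norm_le
  have hfC : ∀ n, ‖f n‖ ≤ C := fun n => hC _ ⟨n, rfl⟩
  -- Interchanging `k` and `l` where necessary removes the absolute value, giving one-sided bounds
  -- for `φ`.
  have hex : ∀ n, ∃ k ≥ n, ∃ l ≥ n, b.toReal < φ (f k - f l) := by
    intro n
    have h1 := hb.trans_le (iInf_le _ n)
    simp only [lt_iSup_iff] at h1
    obtain ⟨k, hk, l, hl, h2⟩ := h1
    rw [ENNReal.lt_ofReal_iff_toReal_lt hb_top, ← map_sub] at h2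
    rcases lt_abs.1 h2 with h3 | h3
    · exact ⟨k, hk, l, hl, h3⟩
    · exact ⟨l, hl, k, hk, by rwa [← map_neg, neg_sub] at h3⟩
  choose k hk l hl hkl using hex
  have hcb' : c.toReal < b.toReal := ENNReal.toReal_strict_mono hb_top hcb
  obtain ⟨c', hcc', hcb''⟩ := exists_between hcb'
  have hC0 : 0 ≤ C := (norm_nonneg _).trans (hfC 0)
  obtain ⟨x, hx, hfr⟩ := H (fun n => f (k n) - f (l n)) (2 * C + 1) (by positivity)
    (fun n => (norm_sub_le _ _).trans (by linarith [hfC (k n), hfC (l n)]))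
    φ ((mem_closedBall_zero_iff (E := StrongDual ℝ (StrongDual ℝ X))).1 hφ) _ hkl _ (sub_pos.2 hcb'')
  have hc_le : c < ENNReal.ofReal c' :=
    (ENNReal.lt_ofReal_iff_toReal_lt (ne_top_of_lt hcb)).2 hcc'
  refine hc_le.trans_le (le_trans ?_ (le_iSup₂ x (by simpa using hx)))
  refine le_iInf fun n => ?_
  obtain ⟨m, hm, hmx⟩ := frequently_atTop.1 hfr n
  refine le_trans ?_ (le_iSup₂_of_le (k m) (hm.trans (hk m))
    (le_iSup₂ (f := fun l' (_ : l' ≥ n) => ENNReal.ofReal |f (k m) x - f l' x|) (l m)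
      (hm.trans (hl m))))
  refine ENNReal.ofReal_le_ofReal ((le_of_lt ?_).trans (le_abs_self _))
  rw [sub_sub_cancel] at hmx
  exact hmx

theorem theorem4p2 (Γ : Type*) :
    IsQuantGrothendieck 1 (lp (fun _ : Γ => ℝ) ∞) := by
  refine ⟨le_rfl, fun f hf => ?_⟩
  rw [ENNReal.ofReal_one, one_mul]
  exact deltaWeak_le_deltaWeakStar (fun _ _ hC hF _ hφ _ hd _ hε =>
    BddFun.exists_frequently_lt hC hF hφ hd hε) hf
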